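/- Fix $d\in\mathbb{N}$. Equip $\mathbb{R}^d$ with the Euclidean norm, and fix standard notations of rational numbers, rational vectors and finite sequences by natural numbers. For a set $X\subseteq\mathbb{R}^d$ and $x\in X$ let $C(X,x)$ denote the connected component of $x$ in $X$, i.e. the union of all connected subsets of $X$ containing $x$. A *name* is an infinite sequence of natural numbers, each of which encodes finite objects, as follows. * A $\rho^d$-name of $x\in\mathbb{R}^d$ is a sequence $(q_n)_{n\ge 0}$ in $\mathbb{Q}^d$ with $\|x-q_n\|\le 2^{-n}$ for all $n$. A $\rho_<$-name of $y\in\mathbb{R}$ is a sequence of rationals with supremum $y$. * A $\theta_<^d$-name of an open set $U\subseteq\mathbb{R}^d$ is a sequence of open Euclidean balls with rational centers and rational radii (empty balls are allowed) whose union is $U$. The set $U$ is *r.e. open* if it has a computable $\theta_<^d$-name. * A $\psi_>^d$-name of a nonempty closed set $A\subseteq\mathbb{R}^d$ (a name of $A$ as a co-r.e. closed set) is a $[\rho^d\to\rho_<]$-name of its distance function $x\mapsto \inf_{a\in A}\|x-a\|$, that is, a sequence encoding a continuous partial function on $\mathbb{N}^{\mathbb{N}}$ that maps every $\rho^d$-name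 of every $x\in\mathbb{R}^d$ to a $\rho_<$-name of $\inf_{a\in A}\|x-a\|$. Here a sequence $r$ encodes the partial function whose value at $q$ has as its $n$-th entry the number $m$ if, as $k=0,1,2,\dots$, the first nonzero value $r(\langle n,(q_0,\dots,q_{k-1})\rangle)$ equals $m+1$. A map is $(\alpha,\beta,\gamma)$-computable if a single Turing machine transforms every pair of an $\alpha$-name and a $\beta$-name of the two components of an argument in its domain into a $\gamma$-name of the value. (a) Every connected component of an r.e. open subset of $\mathbb{R}^d$ is r.e. open; the same holds for path-connected components, which coincide with the connected components of an open set. More precisely, the map $$\{(U,x): x\in U\subseteq\mathbb{R}^d,\ U\text{ open}\}\ni(U,x)\mapsto C(U,x)\subseteq\mathbb{R}^d\ \text{ open}$$ is well defined (i.e. $C(U,x)$ is open) and $(\theta_<^d,\rho^d,\theta_<^d)$-computable. (b) The map $$\{(A,x): x\in A\subseteq[0,1]^d,\ A\text{ closed}\}\ni(A,x)\mapsto C(A,x)\subseteq[0,1]^d\ \text{ closed}$$ is well defined (i.e. $C(A,x)$ is closed) and $(\psi_>^d,\rho^d,\psi_>^d)$-computable. -/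

import Mathlib

namespace RealComp

/-! ### Computable functions on Baire space -/

/-- Partial recursive functionals with `k` infinite input sequences (names) and a numerical
argument: the functions computed by Turing machines that may query the inputs `p 0, …, p (k-1)`.
This is the uniform version of `Nat.RecursiveIn`: one and the same program for all inputs. -/
inductive PartrecFunctional {k : ℕ} : ((Fin k → ℕ → ℕ) → ℕ →. ℕ) → Prop
  | zero : PartrecFunctional fun _ _ => Part.some 0
  | succ : PartrecFunctional fun _ n => Part.some (n + 1)
  | left : PartrecFunctional fun _ n => Part.some n.unpair.1
  | right : PartrecFunctional fun _ n => Part.some n.unpair.2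
  | oracle (i : Fin k) : PartrecFunctional fun p n => Part.some (p i n)
  | pair {F G : (Fin k → ℕ → ℕ) → ℕ →. ℕ} (hF : PartrecFunctional F) (hG : PartrecFunctional G) :
      PartrecFunctional fun p n => (F p n).bind fun a => (G p n).map fun b => Nat.pair a b
  | comp {F G : (Fin k → ℕ → ℕ) → ℕ →. ℕ} (hF : PartrecFunctional F) (hG : PartrecFunctional G) :
      PartrecFunctional fun p n => (G p n).bind (F p)
  | prec {F G : (Fin k → ℕ → ℕ) → ℕ →. ℕ} (hF : PartrecFunctional F) (hG : PartrecFunctional G) :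
      PartrecFunctional fun p n =>
        Nat.rec (motive := fun _ => Part ℕ) (F p n.unpair.1)
          (fun y ih => ih.bind fun i => G p (Nat.pair n.unpair.1 (Nat.pair y i))) n.unpair.2
  | rfind {F : (Fin k → ℕ → ℕ) → ℕ →. ℕ} (hF : PartrecFunctional F) :
      PartrecFunctional fun p a =>
        Nat.rfind fun n => (F p (Nat.pair a n)).map fun m => decide (m = 0)

/-- A naming system for elements of `X`: `δ p x` says that the sequence `p` is a `δ`-name
of `x`. -/
abbrev Naming (X : Type*) := (ℕ → ℕ) → X → Prop

/-- `(δ₁, δ₂, δ₃)`-computability of the map `f` with domain `D`: some machine transforms every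
pair consisting of a `δ₁`-name of `x` and a `δ₂`-name of `y`, where `(x, y) ∈ D`, into a
`δ₃`-name of `f x y` (whose `n`-th entry is printed for every `n`). -/
def IsComputableMap {X Y Z : Type*} (δ₁ : Naming X) (δ₂ : Naming Y) (δ₃ : Naming Z)
    (D : Set (X × Y)) (f : X → Y → Z) : Prop :=
  ∃ F : (Fin 2 → ℕ → ℕ) → ℕ →. ℕ, PartrecFunctional F ∧
    ∀ x y, (x, y) ∈ D → ∀ p q : ℕ → ℕ, δ₁ p x → δ₂ q y →
      ∃ r : ℕ → ℕ, (∀ n, r n ∈ F ![p, q] n) ∧ δ₃ r (f x y)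

/-- Application of (the continuous partial function on Baire space encoded by) the sequence `r`
to the sequence `q`: the value at argument `n` is `m` if, reading longer and longer finite
prefixes of `q`, the first answer of `r` other than `0` ("undecided yet") is `m + 1`. -/
def Applies (r q : ℕ → ℕ) (n m : ℕ) : Prop :=
  ∃ k : ℕ, r (Nat.pair n (Encodable.encode ((List.range k).map q))) = m + 1 ∧
    ∀ j < k, r (Nat.pair n (Encodable.encode ((List.range j).map q))) = 0

/-- The function-space naming system `[δ → δ']`: `r` is a name of `f : X → Y` if the
continuous function encoded by `r` maps each `δ`-name of each `x` to some `δ'`-name of `f x`. -/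
def functionNaming {X Y : Type*} (δ : Naming X) (δ' : Naming Y) : Naming (X → Y) :=
  fun r f => ∀ x q, δ q x → ∃ s : ℕ → ℕ, (∀ n, Applies r q n (s n)) ∧ δ' s (f x)

/-! ### Names of points and of sets in Euclidean space -/

/-- Euclidean space of dimension `d`. -/
abbrev E (d : ℕ) := EuclideanSpace ℝ (Fin d)

/-- The standard (surjective) notation `⟨⟨a, b⟩, c⟩ ↦ (a - b) / (c + 1)` of the rationals. -/
def ratOf (n : ℕ) : ℚ :=
  ((n.unpair.1.unpair.1 : ℚ) - (n.unpair.1.unpair.2 : ℚ)) / ((n.unpair.2 : ℚ) + 1)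

/-- The standard (surjective) notation `⟨n₀, ⟨n₁, ⟨n₂, …⟩⟩⟩ ↦ (ratOf n₀, ratOf n₁, …)` of the
points with rational coordinates. -/
noncomputable def ratVecOf (d : ℕ) (n : ℕ) : E d :=
  WithLp.toLp 2 fun i : Fin d => ((ratOf ((fun m : ℕ => m.unpair.2)^[i] n).unpair.1 : ℚ) : ℝ)

/-- The standard notation of the open rational balls (empty if the radius is not positive). -/
def ballOf (d : ℕ) (n : ℕ) : Set (E d) :=
  Metric.ball (ratVecOf d n.unpair.1) ((ratOf n.unpair.2 : ℚ) : ℝ)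

/-- `ρ^d`: names of points are fast converging sequences of rational points. -/
def rho (d : ℕ) : Naming (E d) :=
  fun p x => ∀ n, ‖x - ratVecOf d (p n)‖ ≤ (2 : ℝ)⁻¹ ^ n

/-- `ρ_<`: names of reals are sequences of rationals with the given supremum. -/
def rhoLower : Naming ℝ :=
  fun p y => IsLUB (Set.range fun n => ((ratOf (p n) : ℚ) : ℝ)) y

/-- `θ_<^d`: names of open sets are sequences of open rational balls exhausting them. -/
def thetaLower (d : ℕ) : Naming (Set (E d)) :=
  fun p U => U = ⋃ n, ballOf d (p n)

/-- `ψ_>^d`: names of (nonempty) closed sets `A` are the `[ρ^d → ρ_<]`-names of the distance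
function of `A`. -/
def psiUpper (d : ℕ) : Naming (Set (E d)) :=
  fun p A => IsClosed A ∧ A.Nonempty ∧
    functionNaming (rho d) rhoLower p (fun x => Metric.infDist x A)

/-- R.e. open sets: some computable sequence of open rational balls exhausts the set. -/
def IsREOpen (d : ℕ) (U : Set (E d)) : Prop :=
  ∃ p : ℕ → ℕ, Computable p ∧ thetaLower d p U

/-- The unit cube `[0,1]^d`. -/
def unitCube (d : ℕ) : Set (E d) := {x | ∀ i, x i ∈ Set.Icc (0 : ℝ) 1}

end RealComp

namespace RealComp

/-! ### Total functionals -/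

namespace PartrecFunctional

variable {k : ℕ}

/-! In both parts membership in the component, respectively exclusion from it, has finite
certificates that can be checked by rational arithmetic on finite prefixes of the names. A
certificate is coded by a number, and the `n`-th entry of the output is obtained by testing the
certificate coded by `n`; a failed test yields a harmless value. The entries are thus primitive
recursive in prefixes of the names, and `PartrecFunctional.of_initialSegments` supplies the machine.

(a) The certificate is a finite chain of successively meeting balls whose first ball contains `x`.
Balls are connected, so a chain stays in the component (`ballOf_ballChain_subset`). Conversely, the
union of the chain balls and the union of the named balls disjoint from it separate `U`, so chains
exhaust the component (`exists_mem_ballOf_ballChain`).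

(b) The certificate is a finite list of grid points near `x` whose surrounding balls are separated
from the rest of `A`. These balls then cover the component
(`connectedComponentIn_subset_iUnion_ball`), so the distance to them bounds the distance to the
component from below. Such bounds come arbitrarily close (`exists_certificate`), because in a
compact set the component of `x` is the intersection of the clopen sets containing `x`
(`exists_isCompact_split`). -/

theorem of_eq {F G : (Fin k → ℕ → ℕ) → ℕ →. ℕ} (hF : PartrecFunctional F)
    (h : ∀ p n, F p n = G p n) : PartrecFunctional G :=
  (funext fun p => funext (h p) : F = G) ▸ hF

theorem of_natPartrec {f : ℕ →. ℕ} (hf : Nat.Partrec f) :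
    PartrecFunctional fun (_ : Fin k → ℕ → ℕ) n => f n := by
  induction hf with
  | zero => exact .zero
  | succ => exact .succ
  | left => exact .left
  | right => exact .right
  | pair _ _ ih₁ ih₂ =>
    convert PartrecFunctional.pair ih₁ ih₂ using 3
    simp [Seq.seq, Part.bind_map, Part.map_eq_map]
  | comp _ _ ih₁ ih₂ => exact .comp ih₁ ih₂
  | prec _ _ ih₁ ih₂ => exact .prec ih₁ ih₂
  | rfind _ ih => exact .rfind ih

/-- Oracle calls to computable sequences can be replaced by their programs. This turns a uniform
result into one about computable names. -/
theorem natPartrec {F : (Fin k → ℕ → ℕ) → ℕ →. ℕ} (hF : PartrecFunctional F)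
    {p : Fin k → ℕ → ℕ} (hp : ∀ i, Computable (p i)) : Nat.Partrec (F p) := by
  induction hF with
  | zero => exact .zero
  | succ => exact .succ
  | left => exact .left
  | right => exact .right
  | oracle i => exact Partrec.nat_iff.1 (hp i)
  | pair _ _ ih₁ ih₂ =>
    convert Nat.Partrec.pair ih₁ ih₂ using 2
    simp [Seq.seq, Part.bind_map, Part.map_eq_map]
  | comp _ _ ih₁ ih₂ => exact .comp ih₁ ih₂
  | prec _ _ ih₁ ih₂ => exact .prec ih₁ ih₂
  | rfind _ ih => exact .rfind ih

theorem of_primrec {f : ℕ → ℕ} (hf : Primrec f) :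
    PartrecFunctional fun (_ : Fin k → ℕ → ℕ) n => Part.some (f n) :=
  of_natPartrec (Partrec.nat_iff.1 hf.to_comp)

theorem pair_some {f g : (Fin k → ℕ → ℕ) → ℕ → ℕ}
    (hf : PartrecFunctional fun p n => Part.some (f p n))
    (hg : PartrecFunctional fun p n => Part.some (g p n)) :
    PartrecFunctional fun p n => Part.some (Nat.pair (f p n) (g p n)) := by
  simpa using hf.pair hg

theorem comp_some {f g : (Fin k → ℕ → ℕ) → ℕ → ℕ}
    (hf : PartrecFunctional fun p n => Part.some (f p n))
    (hg : PartrecFunctional fun p n => Part.some (g p n)) :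
    PartrecFunctional fun p n => Part.some (f p (g p n)) := by
  simpa using hf.comp hg

theorem prec_some {f g : (Fin k → ℕ → ℕ) → ℕ → ℕ}
    (hf : PartrecFunctional fun p n => Part.some (f p n))
    (hg : PartrecFunctional fun p n => Part.some (g p n)) :
    PartrecFunctional fun p n => Part.some
      (Nat.rec (motive := fun _ => ℕ) (f p n.unpair.1)
        (fun y i => g p (Nat.pair n.unpair.1 (Nat.pair y i))) n.unpair.2) := by
  refine (hf.prec hg).of_eq fun p n => ?_
  induction n.unpair.2 with
  | zero => rfl
  | succ y ih => simp [ih]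

end PartrecFunctional

/-- The list of the first `n` entries of a sequence. -/
def initialSegment (p : ℕ → ℕ) (n : ℕ) : List ℕ := (List.range n).map p

@[simp] theorem length_initialSegment (p : ℕ → ℕ) (n : ℕ) :
    (initialSegment p n).length = n := by simp [initialSegment]

theorem initialSegment_getD {p : ℕ → ℕ} {n i : ℕ} (h : i < n) (a : ℕ) :
    (initialSegment p n).getD i a = p i := by
  simp [initialSegment, h]

theorem initialSegment_getD_eq_or (p : ℕ → ℕ) (n i a : ℕ) :
    (initialSegment p n).getD i a = p i ∨ (initialSegment p n).getD i a = a := by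
  rcases lt_or_ge i n with h | h
  · exact .inl (initialSegment_getD h a)
  · right; simp [initialSegment, h]

/-- Primitive recursion on the length: each stage queries the oracle once and appends the answer to
the decoded list. -/
theorem PartrecFunctional.encode_initialSegment {k : ℕ} (i : Fin k) :
    PartrecFunctional fun p n => Part.some (Encodable.encode (initialSegment (p i) n)) := by
  let c : ℕ → ℕ := fun n =>
    Encodable.encode (Denumerable.ofNat (List ℕ) n.unpair.1 ++ [n.unpair.2])
  have hc : Primrec c := Primrec.encode.comp (Primrec.list_concat.comp
    ((Primrec.ofNat _).comp (Primrec.fst.comp .unpair)) (Primrec.snd.comp .unpair))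
  have hr : Primrec fun n : ℕ => n.unpair.2 := Primrec.snd.comp .unpair
  have hl : Primrec fun n : ℕ => n.unpair.1 := Primrec.fst.comp .unpair
  have hstep : PartrecFunctional fun (p : Fin k → ℕ → ℕ) n =>
      Part.some (c (Nat.pair n.unpair.2.unpair.2 (p i n.unpair.2.unpair.1))) :=
    (of_primrec hc).comp_some ((of_primrec (hr.comp hr)).pair_some
      ((PartrecFunctional.oracle i).comp_some (of_primrec (hl.comp hr))))
  have := (prec_some (of_primrec (Primrec.const 0)) hstep).comp_some
    (of_primrec (Primrec₂.natPair.comp (.const 0) .id))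
  refine this.of_eq fun p n => congrArg Part.some ?_
  simp only [id, Nat.unpair_pair]
  induction n with
  | zero => simp [initialSegment]
  | succ n ih =>
    simp only [ih]
    simp [c, initialSegment, List.range_succ]

/-- A primitive recursive function of an argument and long initial segments of two sequences is
a (total) recursive functional of the sequences. -/
theorem PartrecFunctional.of_initialSegments {g : ℕ → List ℕ → List ℕ → ℕ}
    (hg : Primrec fun z : ℕ × List ℕ × List ℕ => g z.1 z.2.1 z.2.2) :
    PartrecFunctional fun (p : Fin 2 → ℕ → ℕ) n => Part.some
      (g n (initialSegment (p 0) (n + 1)) (initialSegment (p 1) (n + 1))) := by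
  have h : Primrec fun n : ℕ =>
      (fun z : ℕ × List ℕ × List ℕ => g z.1 z.2.1 z.2.2) (Denumerable.ofNat _ n) :=
    hg.comp (.ofNat _)
  have := (of_primrec h).comp_some ((of_primrec .id).pair_some
    (((encode_initialSegment (0 : Fin 2)).comp_some (of_primrec .succ)).pair_some
      ((encode_initialSegment 1).comp_some (of_primrec .succ))))
  refine this.of_eq fun p n => ?_
  simp

/-! ### Arithmetic of the notations of rational numbers and points -/

/-- The notation of `(a - b) / (c + 1)`. -/
def ratCode (a b c : ℕ) : ℕ := Nat.pair (Nat.pair a b) c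

theorem ratOf_ratCode (a b c : ℕ) : ratOf (ratCode a b c) = ((a : ℚ) - b) / ((c : ℚ) + 1) := by
  simp [ratOf, ratCode]

theorem ratOf_surjective : Function.Surjective ratOf := by
  intro q
  refine ⟨ratCode q.num.toNat (-q.num).toNat (q.den - 1), ?_⟩
  have hd : ((q.den - 1 : ℕ) : ℚ) + 1 = q.den := by
    exact_mod_cast congrArg (Nat.cast (R := ℚ)) (Nat.sub_add_cancel q.den_pos)
  have hn : ((q.num.toNat : ℕ) : ℚ) - ((-q.num).toNat : ℕ) = q.num := by
    exact_mod_cast Int.toNat_sub_toNat_neg q.num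
  rw [ratOf_ratCode, hd, hn, Rat.num_div_den]

@[simp] theorem ratOf_zero : ratOf 0 = 0 := by
  simp [ratOf, show Nat.unpair 0 = (0, 0) from rfl]

theorem primrec_ratCode {α : Type*} [Primcodable α] {a b c : α → ℕ} (ha : Primrec a)
    (hb : Primrec b) (hc : Primrec c) : Primrec fun x => ratCode (a x) (b x) (c x) :=
  Primrec₂.natPair.comp (Primrec₂.natPair.comp ha hb) hc

/-- Addition of notations of rationals. -/
def ratAdd (m n : ℕ) : ℕ :=
  ratCode (m.unpair.1.unpair.1 * (n.unpair.2 + 1) + n.unpair.1.unpair.1 * (m.unpair.2 + 1))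
    (m.unpair.1.unpair.2 * (n.unpair.2 + 1) + n.unpair.1.unpair.2 * (m.unpair.2 + 1))
    -- Denominators are stored minus one: `(c + 1) * (c' + 1) = (c * c' + c + c') + 1`.
    (m.unpair.2 * n.unpair.2 + m.unpair.2 + n.unpair.2)

/-- Subtraction of notations of rationals. -/
def ratSub (m n : ℕ) : ℕ :=
  ratCode (m.unpair.1.unpair.1 * (n.unpair.2 + 1) + n.unpair.1.unpair.2 * (m.unpair.2 + 1))
    (m.unpair.1.unpair.2 * (n.unpair.2 + 1) + n.unpair.1.unpair.1 * (m.unpair.2 + 1))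
    (m.unpair.2 * n.unpair.2 + m.unpair.2 + n.unpair.2)

/-- Squaring of notations of rationals. -/
def ratSq (m : ℕ) : ℕ :=
  ratCode (m.unpair.1.unpair.1 * m.unpair.1.unpair.1 + m.unpair.1.unpair.2 * m.unpair.1.unpair.2)
    (2 * (m.unpair.1.unpair.1 * m.unpair.1.unpair.2))
    (m.unpair.2 * m.unpair.2 + m.unpair.2 + m.unpair.2)

@[simp] theorem ratOf_ratAdd (m n : ℕ) : ratOf (ratAdd m n) = ratOf m + ratOf n := by
  rw [ratAdd, ratOf_ratCode, ratOf, ratOf]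
  have h₁ : (m.unpair.2 : ℚ) + 1 ≠ 0 := by positivity
  have h₂ : (n.unpair.2 : ℚ) + 1 ≠ 0 := by positivity
  have h : ((m.unpair.2 * n.unpair.2 + m.unpair.2 + n.unpair.2 : ℕ) : ℚ) + 1 =
    (m.unpair.2 + 1) * (n.unpair.2 + 1) := by push_cast; ring
  rw [h]
  push_cast
  field_simp
  ring

@[simp] theorem ratOf_ratSub (m n : ℕ) : ratOf (ratSub m n) = ratOf m - ratOf n := by
  rw [ratSub, ratOf_ratCode, ratOf, ratOf]
  have h₁ : (m.unpair.2 : ℚ) + 1 ≠ 0 := by positivity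
  have h₂ : (n.unpair.2 : ℚ) + 1 ≠ 0 := by positivity
  have h : ((m.unpair.2 * n.unpair.2 + m.unpair.2 + n.unpair.2 : ℕ) : ℚ) + 1 =
    (m.unpair.2 + 1) * (n.unpair.2 + 1) := by push_cast; ring
  rw [h]
  push_cast
  field_simp
  ring

@[simp] theorem ratOf_ratSq (m : ℕ) : ratOf (ratSq m) = ratOf m ^ 2 := by
  rw [ratSq, ratOf_ratCode, ratOf]
  have h₁ : (m.unpair.2 : ℚ) + 1 ≠ 0 := by positivity
  have h : ((m.unpair.2 * m.unpair.2 + m.unpair.2 + m.unpair.2 : ℕ) : ℚ) + 1 =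
    (m.unpair.2 + 1) * (m.unpair.2 + 1) := by push_cast; ring
  rw [h]
  push_cast
  field_simp
  ring

theorem primrec_ratAdd : Primrec₂ ratAdd := by
  have l₁ : Primrec fun z : ℕ × ℕ => z.1.unpair := Primrec.unpair.comp .fst
  have l₂ : Primrec fun z : ℕ × ℕ => z.2.unpair := Primrec.unpair.comp .snd
  have c₁ := Primrec.snd.comp l₁
  have c₂ := Primrec.snd.comp l₂
  have n₁ := Primrec.unpair.comp (Primrec.fst.comp l₁)
  have n₂ := Primrec.unpair.comp (Primrec.fst.comp l₂)
  exact primrec_ratCode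
    (Primrec.nat_add.comp
      (Primrec.nat_mul.comp (Primrec.fst.comp n₁) (Primrec.succ.comp c₂))
      (Primrec.nat_mul.comp (Primrec.fst.comp n₂) (Primrec.succ.comp c₁)))
    (Primrec.nat_add.comp
      (Primrec.nat_mul.comp (Primrec.snd.comp n₁) (Primrec.succ.comp c₂))
      (Primrec.nat_mul.comp (Primrec.snd.comp n₂) (Primrec.succ.comp c₁)))
    (Primrec.nat_add.comp (Primrec.nat_add.comp (Primrec.nat_mul.comp c₁ c₂) c₁) c₂)

theorem primrec_ratSub : Primrec₂ ratSub := by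
  have l₁ : Primrec fun z : ℕ × ℕ => z.1.unpair := Primrec.unpair.comp .fst
  have l₂ : Primrec fun z : ℕ × ℕ => z.2.unpair := Primrec.unpair.comp .snd
  have c₁ := Primrec.snd.comp l₁
  have c₂ := Primrec.snd.comp l₂
  have n₁ := Primrec.unpair.comp (Primrec.fst.comp l₁)
  have n₂ := Primrec.unpair.comp (Primrec.fst.comp l₂)
  exact primrec_ratCode
    (Primrec.nat_add.comp
      (Primrec.nat_mul.comp (Primrec.fst.comp n₁) (Primrec.succ.comp c₂))
      (Primrec.nat_mul.comp (Primrec.snd.comp n₂) (Primrec.succ.comp c₁)))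
    (Primrec.nat_add.comp
      (Primrec.nat_mul.comp (Primrec.snd.comp n₁) (Primrec.succ.comp c₂))
      (Primrec.nat_mul.comp (Primrec.fst.comp n₂) (Primrec.succ.comp c₁)))
    (Primrec.nat_add.comp (Primrec.nat_add.comp (Primrec.nat_mul.comp c₁ c₂) c₁) c₂)

theorem primrec_ratSq : Primrec ratSq := by
  have c := Primrec.snd.comp .unpair
  have n := Primrec.unpair.comp (Primrec.fst.comp .unpair)
  have a := Primrec.fst.comp n
  have b := Primrec.snd.comp n
  exact primrec_ratCode
    (Primrec.nat_add.comp (Primrec.nat_mul.comp a a) (Primrec.nat_mul.comp b b))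
    (Primrec.nat_mul.comp (.const 2) (Primrec.nat_mul.comp a b))
    (Primrec.nat_add.comp (Primrec.nat_add.comp (Primrec.nat_mul.comp c c) c) c)

/-- Cross-multiplying and moving the subtracted parts to the other side leaves a comparison of
natural numbers. -/
theorem primrecPred_ratOf_lt {α : Type*} [Primcodable α] {f g : α → ℕ} (hf : Primrec f)
    (hg : Primrec g) : PrimrecPred fun x => ratOf (f x) < ratOf (g x) := by
  suffices H : PrimrecPred fun z : ℕ × ℕ => ratOf z.1 < ratOf z.2 from
    PrimrecPred.comp (f := fun x => (f x, g x)) H (hf.pair hg)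
  have l₁ : Primrec fun z : ℕ × ℕ => z.1.unpair := Primrec.unpair.comp .fst
  have l₂ : Primrec fun z : ℕ × ℕ => z.2.unpair := Primrec.unpair.comp .snd
  have c₁ := Primrec.snd.comp l₁
  have c₂ := Primrec.snd.comp l₂
  have n₁ := Primrec.unpair.comp (Primrec.fst.comp l₁)
  have n₂ := Primrec.unpair.comp (Primrec.fst.comp l₂)
  have h := PrimrecRel.comp Primrec.nat_lt
    (Primrec.nat_add.comp
      (Primrec.nat_mul.comp (Primrec.fst.comp n₁) (Primrec.succ.comp c₂))
      (Primrec.nat_mul.comp (Primrec.snd.comp n₂) (Primrec.succ.comp c₁)))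
    (Primrec.nat_add.comp
      (Primrec.nat_mul.comp (Primrec.fst.comp n₂) (Primrec.succ.comp c₁))
      (Primrec.nat_mul.comp (Primrec.snd.comp n₁) (Primrec.succ.comp c₂)))
  refine PrimrecPred.of_eq h fun z => ?_
  rw [ratOf.eq_1 z.1, ratOf.eq_1 z.2, div_lt_div_iff₀ (by positivity) (by positivity), ← Nat.cast_lt (α := ℚ)]
  push_cast
  constructor <;> intro h <;> linarith

/-- A notation of the square of the distance of two rational points. -/
def sqDistCode : ℕ → ℕ → ℕ → ℕ
  | 0, _, _ => 0
  | d + 1, u, v =>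
    ratAdd (ratSq (ratSub u.unpair.1 v.unpair.1)) (sqDistCode d u.unpair.2 v.unpair.2)

theorem primrec_sqDistCode (d : ℕ) : Primrec₂ (sqDistCode d) := by
  induction d with
  | zero => exact Primrec.const 0
  | succ d ih =>
    have l₁ : Primrec fun z : ℕ × ℕ => z.1.unpair := Primrec.unpair.comp .fst
    have l₂ : Primrec fun z : ℕ × ℕ => z.2.unpair := Primrec.unpair.comp .snd
    exact primrec_ratAdd.comp
      (primrec_ratSq.comp (primrec_ratSub.comp (Primrec.fst.comp l₁) (Primrec.fst.comp l₂)))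
      (ih.comp (Primrec.snd.comp l₁) (Primrec.snd.comp l₂))

theorem ratVecOf_zero (d n : ℕ) : ratVecOf (d + 1) n 0 = ratOf n.unpair.1 := rfl

theorem ratVecOf_succ (d n : ℕ) (i : Fin d) :
    ratVecOf (d + 1) n i.succ = ratVecOf d n.unpair.2 i := rfl

theorem ratOf_sqDistCode (d u v : ℕ) :
    (ratOf (sqDistCode d u v) : ℝ) = dist (ratVecOf d u) (ratVecOf d v) ^ 2 := by
  rw [EuclideanSpace.dist_eq, Real.sq_sqrt (Finset.sum_nonneg fun _ _ => sq_nonneg _)]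
  induction d generalizing u v with
  | zero => simp [sqDistCode]
  | succ d ih =>
    rw [Fin.sum_univ_succ]
    simp only [ratVecOf_zero, ratVecOf_succ, sqDistCode, ratOf_ratAdd, ratOf_ratSq, ratOf_ratSub,
      Rat.cast_add, ih, Rat.cast_pow, Rat.cast_sub, Real.dist_eq, sq_abs]

/-- The decidable relation that two rational points are closer than a given rational. -/
def DistLt (d u v t : ℕ) : Prop :=
  ratOf 0 < ratOf t ∧ ratOf (sqDistCode d u v) < ratOf (ratSq t)

/-- The distance of rational points need not be rational, hence the comparison of squares; it is
faithful only for positive bounds, hence the sign condition. -/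
theorem distLt_iff {d u v t : ℕ} :
    DistLt d u v t ↔ dist (ratVecOf d u) (ratVecOf d v) < ratOf t := by
  rw [DistLt, ← Rat.cast_lt (K := ℝ), ← Rat.cast_lt (K := ℝ), ratOf_sqDistCode, ratOf_ratSq,
    ratOf_zero, Rat.cast_zero, Rat.cast_pow]
  constructor
  · rintro ⟨h₀, h⟩
    exact lt_of_pow_lt_pow_left₀ 2 h₀.le h
  · intro h
    exact ⟨dist_nonneg.trans_lt h, pow_lt_pow_left₀ h dist_nonneg two_ne_zero⟩

theorem primrecPred_distLt (d : ℕ) {α : Type*} [Primcodable α] {u v t : α → ℕ} (hu : Primrec u)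
    (hv : Primrec v) (ht : Primrec t) : PrimrecPred fun x => DistLt d (u x) (v x) (t x) :=
  (primrecPred_ratOf_lt (.const 0) ht).and
    (primrecPred_ratOf_lt ((primrec_sqDistCode d).comp hu hv)
      (primrec_ratSq.comp ht))

theorem dist_le_of_forall_abs_sub_le {d : ℕ} {x y : E d} {δ : ℝ} (h : ∀ i, |x i - y i| ≤ δ) :
    dist x y ≤ d * δ := by
  rw [EuclideanSpace.dist_eq]
  calc √(∑ i, dist (x i) (y i) ^ 2)
      ≤ √((∑ i, dist (x i) (y i)) ^ 2) :=
        Real.sqrt_le_sqrt (Finset.sum_sq_le_sq_sum_of_nonneg fun _ _ => dist_nonneg)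
    _ = ∑ i, dist (x i) (y i) := Real.sqrt_sq (Finset.sum_nonneg fun _ _ => dist_nonneg)
    _ ≤ ∑ _i : Fin d, δ := Finset.sum_le_sum fun i _ => h i
    _ = d * δ := by simp

theorem exists_ratVecOf_dist_lt {d : ℕ} (y : E d) {ε : ℝ} (hε : 0 < ε) :
    ∃ n, dist y (ratVecOf d n) < ε := by
  suffices h : ∀ (d : ℕ) (f : Fin d → ℝ) (δ : ℝ), 0 < δ →
      ∃ n, ∀ i, |f i - ratVecOf d n i| < δ by
    obtain ⟨n, hn⟩ := h d y (ε / (d + 1)) (by positivity)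
    refine ⟨n, ?_⟩
    calc dist y (ratVecOf d n) ≤ d * (ε / (d + 1)) :=
          dist_le_of_forall_abs_sub_le fun i => (hn i).le
      _ < ε := by
          rw [mul_div_assoc', div_lt_iff₀ (by positivity)]
          nlinarith
  intro d
  induction d with
  | zero => exact fun _ _ _ => ⟨0, fun i => i.elim0⟩
  | succ d ih =>
    intro f δ hδ
    obtain ⟨n, hn⟩ := ih (fun i => f i.succ) δ hδ
    obtain ⟨q, hq⟩ := exists_rat_near (f 0) hδ
    obtain ⟨a, rfl⟩ := ratOf_surjective q
    refine ⟨Nat.pair a n, Fin.cases ?_ fun i => ?_⟩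
    · simpa [ratVecOf_zero] using hq
    · simpa [ratVecOf_succ] using hn i

/-- The weaker bound `1 / (m + 1)` suffices everywhere and has the simple code `ratCode 1 0 m`. -/
theorem rho.dist_le {d : ℕ} {q : ℕ → ℕ} {x : E d} (h : rho d q x) (m : ℕ) :
    dist x (ratVecOf d (q m)) ≤ 1 / ((m : ℝ) + 1) := by
  rw [dist_eq_norm]
  refine (h m).trans ?_
  rw [inv_pow, inv_eq_one_div]
  refine one_div_le_one_div_of_le (by positivity) ?_
  exact_mod_cast Nat.lt_two_pow_self (n := m)

theorem rho_const (d c : ℕ) : rho d (fun _ => c) (ratVecOf d c) := fun n => by simp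

theorem ratOf_inv_succ (m : ℕ) : (ratOf (ratCode 1 0 m) : ℝ) = 1 / ((m : ℝ) + 1) := by
  rw [ratOf_ratCode]
  push_cast
  rw [sub_zero]

/-! ### Components of open sets -/

@[simp] theorem ballOf_zero (d : ℕ) : ballOf d 0 = ∅ := by
  simp [ballOf, show Nat.unpair 0 = (0, 0) from rfl]

/-- The point with name-entry `c` at precision `1 / (m + 1)` is certified to lie in the ball. -/
def BallContains (d b c m : ℕ) : Prop :=
  DistLt d c b.unpair.1 (ratSub b.unpair.2 (ratCode 1 0 m))

/-- Two rational balls have a common point. -/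
def BallMeets (d b b' : ℕ) : Prop :=
  (ratOf 0 < ratOf b.unpair.2 ∧ ratOf 0 < ratOf b'.unpair.2) ∧
    DistLt d b.unpair.1 b'.unpair.1 (ratAdd b.unpair.2 b'.unpair.2)

theorem BallContains.mem {d b c m : ℕ} {x : E d}
    (h : BallContains d b c m) (hx : dist x (ratVecOf d c) ≤ 1 / ((m : ℝ) + 1)) :
    x ∈ ballOf d b := by
  rw [BallContains, distLt_iff, ratOf_ratSub, Rat.cast_sub, ratOf_inv_succ] at h
  rw [ballOf, Metric.mem_ball]
  linarith [dist_triangle x (ratVecOf d c) (ratVecOf d b.unpair.1)]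

theorem exists_ballContains {d b : ℕ} {x : E d} {q : ℕ → ℕ} (hq : rho d q x)
    (hx : x ∈ ballOf d b) : ∃ m, BallContains d b (q m) m := by
  rw [ballOf, Metric.mem_ball] at hx
  obtain ⟨m, hm⟩ := exists_nat_one_div_lt (half_pos (sub_pos.2 hx))
  refine ⟨m, ?_⟩
  rw [BallContains, distLt_iff, ratOf_ratSub, Rat.cast_sub, ratOf_inv_succ]
  have := hq.dist_le m
  rw [dist_comm] at this
  linarith [dist_triangle (ratVecOf d (q m)) x (ratVecOf d b.unpair.1)]

theorem ballMeets_iff {d b b' : ℕ} :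
    BallMeets d b b' ↔ (ballOf d b ∩ ballOf d b').Nonempty := by
  simp only [BallMeets, distLt_iff, ratOf_zero, ratOf_ratAdd, Rat.cast_add]
  by_cases h : 0 < ratOf b.unpair.2
  · by_cases h' : 0 < ratOf b'.unpair.2
    · have := disjoint_ball_ball_iff (x := ratVecOf d b.unpair.1) (y := ratVecOf d b'.unpair.1)
        (Rat.cast_pos (K := ℝ) |>.2 h) (Rat.cast_pos (K := ℝ) |>.2 h')
      rw [← Set.not_disjoint_iff_nonempty_inter, ballOf, ballOf, this]
      simp [h, h']
    · have : ballOf d b' = ∅ := Metric.ball_eq_empty.2 (by exact_mod_cast not_lt.1 h')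
      simp [this, h']
  · have : ballOf d b = ∅ := Metric.ball_eq_empty.2 (by exact_mod_cast not_lt.1 h)
    simp [this, h]

open Classical in
/-- Pass from a ball to another ball if they meet. -/
noncomputable def ballStep (d b b' : ℕ) : ℕ := if BallMeets d b b' then b' else b

open Classical in
/-- The last ball of a chain of balls of the sequence `p` which starts with the ball `p i`,
provided that this contains the point approximated by `c`. -/
noncomputable def ballChain (d : ℕ) (p : ℕ → ℕ) (c m i : ℕ) (l : List ℕ) : ℕ :=
  (l.map p).foldl (ballStep d) (if BallContains d (p i) c m then p i else 0)

theorem ballOf_isPreconnected (d b : ℕ) : IsPreconnected (ballOf d b) :=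
  (convex_ball _ _).isPreconnected

open Classical in
-- A connected subset of `U` meeting the component lies inside it, so each step of the chain
-- preserves inclusion. A chain whose first ball is not certified starts from the empty ball `0` and
-- can never leave it.
theorem ballOf_ballChain_subset {d c m i : ℕ} {U : Set (E d)} {x : E d} {p : ℕ → ℕ}
    (hp : ∀ j, ballOf d (p j) ⊆ U)
    (hc : dist x (ratVecOf d c) ≤ 1 / ((m : ℝ) + 1)) (l : List ℕ) :
    ballOf d (ballChain d p c m i l) ⊆ connectedComponentIn U x := by
  rw [ballChain]
  generalize hb : (if BallContains d (p i) c m then p i else 0) = b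
  have hb : ballOf d b ⊆ connectedComponentIn U x := by
    subst hb
    split_ifs with h
    · exact (ballOf_isPreconnected d _).subset_connectedComponentIn (h.mem hc) (hp i)
    · simp
  clear * - hb hp
  induction l generalizing b with
  | nil => exact hb
  | cons j l ih =>
    refine ih (ballStep d b (p j)) ?_
    rw [ballStep]
    split_ifs with h
    · obtain ⟨z, hz, hz'⟩ := ballMeets_iff.1 h
      rw [connectedComponentIn_eq (hb hz)]
      exact (ballOf_isPreconnected d _).subset_connectedComponentIn hz' (hp j)
    · exact hb

/-- `V` is everything reached by chains and `W` the union of the named balls disjoint from `V`. A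
named ball meeting `V` extends a chain, so these disjoint open sets cover `U`; the component
contains `x ∈ V` and hence stays in `V`. -/
theorem exists_mem_ballOf_ballChain {d : ℕ} {U : Set (E d)} {x : E d} {p q : ℕ → ℕ}
    (hp : thetaLower d p U) (hq : rho d q x) {y : E d} (hy : y ∈ connectedComponentIn U x) :
    ∃ m i l, y ∈ ballOf d (ballChain d p (q m) m i l) := by
  have hx : x ∈ U := connectedComponentIn_nonempty_iff.1 ⟨y, hy⟩
  let V : Set (E d) := ⋃ (m) (i) (l), ballOf d (ballChain d p (q m) m i l)
  let W : Set (E d) := ⋃ (j) (_ : Disjoint (ballOf d (p j)) V), ballOf d (p j)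
  have hVo : IsOpen V := isOpen_iUnion fun _ => isOpen_iUnion fun _ => isOpen_iUnion fun _ =>
    Metric.isOpen_ball
  have hWo : IsOpen W := isOpen_iUnion fun _ => isOpen_iUnion fun _ => Metric.isOpen_ball
  have hVW : Disjoint V W := by
    simp only [W, Set.disjoint_iUnion_right]
    exact fun j hj => hj.symm
  have hU : U ⊆ V ∪ W := by
    intro z hz
    obtain ⟨j, hj⟩ := Set.mem_iUnion.1 (hp ▸ hz : z ∈ ⋃ n, ballOf d (p n))
    by_cases h : Disjoint (ballOf d (p j)) V
    · exact .inr (Set.mem_iUnion₂.2 ⟨j, h, hj⟩)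
    · obtain ⟨w, hw, hwV⟩ := Set.not_disjoint_iff.1 h
      simp only [V, Set.mem_iUnion] at hwV
      obtain ⟨m, i, l, hwl⟩ := hwV
      left
      simp only [V, Set.mem_iUnion]
      refine ⟨m, i, l ++ [j], ?_⟩
      have : BallMeets d (ballChain d p (q m) m i l) (p j) := ballMeets_iff.2 ⟨w, hwl, hw⟩
      rw [ballChain, List.map_append, List.foldl_append]
      change z ∈ ballOf d (ballStep d (ballChain d p (q m) m i l) (p j))
      rwa [ballStep, if_pos this]
  have hxV : x ∈ V := by
    obtain ⟨j, hj⟩ := Set.mem_iUnion.1 (hp ▸ hx : x ∈ ⋃ n, ballOf d (p n))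
    obtain ⟨m, hm⟩ := exists_ballContains hq hj
    simp only [V, Set.mem_iUnion]
    refine ⟨m, j, [], ?_⟩
    simpa [ballChain, hm] using hj
  have := isPreconnected_connectedComponentIn.subset_left_of_subset_union hVo hWo hVW
    ((connectedComponentIn_subset U x).trans hU) ⟨x, mem_connectedComponentIn hx, hxV⟩ hy
  simpa only [V, Set.mem_iUnion] using this

/-! ### Primitive recursive enumeration of the chains -/

theorem ballChain_congr {d c m i : ℕ} {p p' : ℕ → ℕ} {l : List ℕ} (hi : p i = p' i)
    (hl : ∀ j ∈ l, p j = p' j) : ballChain d p c m i l = ballChain d p' c m i l := by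
  rw [ballChain, ballChain, hi, List.map_congr_left hl]

theorem primrecPred_ballContains (d : ℕ) {α : Type*} [Primcodable α] {b c m : α → ℕ}
    (hb : Primrec b) (hc : Primrec c) (hm : Primrec m) :
    PrimrecPred fun x => BallContains d (b x) (c x) (m x) := by
  have l := Primrec.unpair.comp hb
  have h := primrecPred_distLt d hc (Primrec.fst.comp l)
    (primrec_ratSub.comp (Primrec.snd.comp l) (primrec_ratCode (.const 1) (.const 0) hm))
  exact h.of_eq fun _ => Iff.rfl

theorem primrecPred_ballMeets (d : ℕ) {α : Type*} [Primcodable α] {b b' : α → ℕ}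
    (hb : Primrec b) (hb' : Primrec b') : PrimrecPred fun x => BallMeets d (b x) (b' x) := by
  have l₁ := Primrec.unpair.comp hb
  have l₂ := Primrec.unpair.comp hb'
  have h₁ := primrecPred_ratOf_lt (.const 0) (Primrec.snd.comp l₁)
  have h₂ := primrecPred_ratOf_lt (.const 0) (Primrec.snd.comp l₂)
  have h := primrecPred_distLt d (Primrec.fst.comp l₁) (Primrec.fst.comp l₂)
    (primrec_ratAdd.comp (Primrec.snd.comp l₁) (Primrec.snd.comp l₂))
  exact ((h₁.and h₂).and h).of_eq fun _ => Iff.rfl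

theorem primrec_ballStep (d : ℕ) : Primrec₂ (ballStep d) := by
  classical
  exact Primrec.ite (primrecPred_ballMeets d .fst .snd) .snd .fst

/-- The `n`-th ball of the enumeration of the component: `n` encodes a chain together with a
number that makes the available initial segments long enough. -/
noncomputable def componentBall (d n : ℕ) (P Q : List ℕ) : ℕ :=
  let z := Denumerable.ofNat (ℕ × ℕ × ℕ × List ℕ) n
  ballChain d (fun i => P.getD i 0) (Q.getD z.2.1 0) z.2.1 z.2.2.1 z.2.2.2

theorem primrec_ballChain (d : ℕ) {α : Type*} [Primcodable α] {P Q : α → List ℕ}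
    {m i : α → ℕ} {l : α → List ℕ} (hP : Primrec P) (hQ : Primrec Q) (hm : Primrec m)
    (hi : Primrec i) (hl : Primrec l) :
    Primrec fun a => ballChain d (fun j => (P a).getD j 0) ((Q a).getD (m a) 0) (m a) (i a)
      (l a) := by
  classical
  have hPi : Primrec fun a => (P a).getD (i a) 0 := (Primrec.list_getD 0).comp hP hi
  have hQm : Primrec fun a => (Q a).getD (m a) 0 := (Primrec.list_getD 0).comp hQ hm
  have hstart := Primrec.ite (primrecPred_ballContains d hPi hQm hm) hPi (.const 0)
  have hget : Primrec₂ fun (a : α) (j : ℕ) => (P a).getD j 0 :=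
    (Primrec.list_getD 0).comp (hP.comp .fst) .snd
  have hstep : Primrec₂ fun (_ : α) (z : ℕ × ℕ) => ballStep d z.1 z.2 :=
    (primrec_ballStep d).comp (Primrec.fst.comp .snd) (Primrec.snd.comp .snd)
  have := Primrec.list_foldl (Primrec.list_map hl hget) hstart hstep
  refine this.of_eq fun a => ?_
  rw [ballChain]

theorem primrec_componentBall (d : ℕ) :
    Primrec fun z : ℕ × List ℕ × List ℕ => componentBall d z.1 z.2.1 z.2.2 := by
  have hz : Primrec fun z : ℕ × List ℕ × List ℕ =>
      Denumerable.ofNat (ℕ × ℕ × ℕ × List ℕ) z.1 := (Primrec.ofNat _).comp .fst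
  have h₁ := Primrec.snd.comp hz
  have h₂ := Primrec.snd.comp h₁
  exact primrec_ballChain d (Primrec.fst.comp .snd) (Primrec.snd.comp .snd) (Primrec.fst.comp h₁)
    (Primrec.fst.comp h₂) (Primrec.snd.comp h₂)

/-- Indices beyond the prefix of `p` read as the empty ball, so truncation is sound. Every chain is
nevertheless tested on long enough prefixes, because its code may carry an arbitrarily large padding
number `N`. -/
theorem thetaLower_componentBall {d : ℕ} {U : Set (E d)} {x : E d} {p q : ℕ → ℕ}
    (hp : thetaLower d p U) (hq : rho d q x) :
    thetaLower d
      (fun n => componentBall d n (initialSegment p (n + 1)) (initialSegment q (n + 1)))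
      (connectedComponentIn U x) := by
  refine Set.Subset.antisymm (fun y hy => ?_) (Set.iUnion_subset fun n => ?_)
  · obtain ⟨m, i, l, h⟩ := exists_mem_ballOf_ballChain hp hq hy
    obtain ⟨N, hN⟩ := (m :: i :: l).toFinset.bddAbove
    have hN' : ∀ j ∈ m :: i :: l, j ≤ N := fun j hj => hN (by simpa using hj)
    refine Set.mem_iUnion.2 ⟨Encodable.encode (N, m, i, l), ?_⟩
    set n := Encodable.encode (N, m, i, l) with hn
    have hNn : N < n + 1 := Nat.lt_succ_of_le (by
      rw [hn, Encodable.encode_prod_val]; exact Nat.left_le_pair _ _)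
    have hget : ∀ (s : ℕ → ℕ), ∀ j ∈ m :: i :: l, (initialSegment s (n + 1)).getD j 0 = s j :=
      fun s j hj => initialSegment_getD ((hN' j hj).trans_lt hNn) 0
    change y ∈ ballOf d (componentBall d n _ _)
    rw [componentBall, hn, Denumerable.ofNat_encode]
    dsimp only
    rw [← hn, hget q m (by simp), ballChain_congr (hget p i (by simp))
      fun j hj => hget p j (by simp [hj])]
    exact h
  · change ballOf d (componentBall d n _ _) ⊆ _
    rw [componentBall]
    have hm : (Denumerable.ofNat (ℕ × ℕ × ℕ × List ℕ) n).2.1 < n + 1 := by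
      simp only [Denumerable.prod_ofNat_val, Denumerable.ofNat_nat]
      exact Nat.lt_succ_of_le ((Nat.unpair_left_le _).trans (Nat.unpair_right_le _))
    refine ballOf_ballChain_subset (fun j => ?_) ?_ _
    · rcases initialSegment_getD_eq_or p (n + 1) j 0 with h | h <;> rw [h]
      · exact hp ▸ Set.subset_iUnion (fun n => ballOf d (p n)) j
      · simp
    · rw [initialSegment_getD hm]
      exact hq.dist_le _

theorem isComputableMap_connectedComponentIn_isOpen (d : ℕ) :
    IsComputableMap (thetaLower d) (rho d) (thetaLower d)
      {z : Set (E d) × E d | IsOpen z.1 ∧ z.2 ∈ z.1} (fun U x => connectedComponentIn U x) :=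
  ⟨_, .of_initialSegments (primrec_componentBall d), fun _ _ _ _ _ hp hq =>
    ⟨_, fun _ => Part.mem_some _, thetaLower_componentBall hp hq⟩⟩

theorem thetaLower.isOpen {d : ℕ} {p : ℕ → ℕ} {U : Set (E d)} (hp : thetaLower d p U) :
    IsOpen U := hp ▸ isOpen_iUnion fun _ => Metric.isOpen_ball

/-- The point `x` may have no computable name, but its component is open and so contains a rational
point, which has a constant name and the same component. -/
theorem isREOpen_connectedComponentIn {d : ℕ} {U : Set (E d)} (hU : IsREOpen d U) {x : E d}
    (hx : x ∈ U) : IsREOpen d (connectedComponentIn U x) := by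
  obtain ⟨p, hpc, hp⟩ := hU
  obtain ⟨ε, hε, hball⟩ := Metric.isOpen_iff.1 hp.isOpen.connectedComponentIn x
    (mem_connectedComponentIn hx)
  obtain ⟨c, hc⟩ := exists_ratVecOf_dist_lt x hε
  have hcU : ratVecOf d c ∈ connectedComponentIn U x := hball (by rwa [Metric.mem_ball, dist_comm])
  have hF := PartrecFunctional.of_initialSegments (primrec_componentBall d)
  refine ⟨_, ?_, connectedComponentIn_eq hcU ▸ thetaLower_componentBall hp (rho_const d c)⟩
  refine Partrec.nat_iff.2 (hF.natPartrec (p := ![p, fun _ => c]) fun i => ?_)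
  fin_cases i
  · exact hpc
  · exact Computable.const c

theorem pathComponentIn_eq_connectedComponentIn {X : Type*} [TopologicalSpace X]
    [LocallyPathConnectedSpace X] {U : Set X} (hU : IsOpen U) {x : X} (hx : x ∈ U) :
    pathComponentIn U x = connectedComponentIn U x := by
  refine ((isPathConnected_pathComponentIn hx).isConnected.isPreconnected.subset_connectedComponentIn
    (mem_pathComponentIn_self hx) pathComponentIn_subset).antisymm ?_
  have h : IsConnected (connectedComponentIn U x) := isConnected_connectedComponentIn_iff.2 hx
  exact (hU.connectedComponentIn.isConnected_iff_isPathConnected.1 h).subset_pathComponentIn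
    (mem_connectedComponentIn hx) (connectedComponentIn_subset U x)

/-! ### Components of compact sets: topology -/

/-- In a compact Hausdorff space components are intersections of clopen sets. This family is
directed, so by compactness one of its members already lies in the open `δ`-neighbourhood of the
component. -/
theorem exists_isCompact_split {X : Type*} [MetricSpace X] {A : Set X} (hA : IsCompact A) {x : X}
    (hx : x ∈ A) {δ : ℝ} (hδ : 0 < δ) :
    ∃ B B' : Set X, A = B ∪ B' ∧ IsCompact B ∧ IsCompact B' ∧ Disjoint B B' ∧ x ∈ B ∧
      ∀ b ∈ B, Metric.infDist b (connectedComponentIn A x) < δ := by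
  have : CompactSpace A := isCompact_iff_compactSpace.1 hA
  let x' : A := ⟨x, hx⟩
  let V : Set A := {a | Metric.infDist (a : X) (connectedComponentIn A x) < δ}
  have hV : IsOpen V :=
    isOpen_lt ((Metric.continuous_infDist_pt _).comp continuous_subtype_val) continuous_const
  have hsub : (⋂ s : { s : Set A // IsClopen s ∧ x' ∈ s }, (s : Set A)) ⊆ V := by
    rw [← connectedComponent_eq_iInter_isClopen]
    intro a ha
    have : (a : X) ∈ connectedComponentIn A x := by
      rw [connectedComponentIn_eq_image hx]
      exact Set.mem_image_of_mem _ ha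
    simpa [V, Metric.infDist_zero_of_mem this] using hδ
  have : Nonempty { s : Set A // IsClopen s ∧ x' ∈ s } := ⟨⟨Set.univ, isClopen_univ, trivial⟩⟩
  obtain ⟨⟨s, hs, hxs⟩, hsV⟩ := exists_subset_nhds_of_compactSpace
    (V := fun s : { s : Set A // IsClopen s ∧ x' ∈ s } => (s : Set A))
    (fun s t => ⟨⟨s ∩ t, s.2.1.inter t.2.1, s.2.2, t.2.2⟩, Set.inter_subset_left,
      Set.inter_subset_right⟩) (fun s => s.2.1.isClosed) fun a ha => hV.mem_nhds (hsub ha)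
  refine ⟨Subtype.val '' s, Subtype.val '' sᶜ, ?_, hs.isClosed.isCompact.image continuous_subtype_val,
    hs.compl.isClosed.isCompact.image continuous_subtype_val,
    (Set.disjoint_image_iff Subtype.val_injective).2 disjoint_compl_right, ⟨x', hxs, rfl⟩, ?_⟩
  · rw [← Set.image_union, Set.union_compl_self, Set.image_univ, Subtype.range_coe]
  · rintro _ ⟨a, ha, rfl⟩
    exact hsV ha

theorem exists_pos_forall_le_dist {X : Type*} [MetricSpace X] {B B' : Set X} (hB : IsCompact B)
    (hB' : IsCompact B') (h : Disjoint B B') :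
    ∃ η : ℝ, 0 < η ∧ ∀ b ∈ B, ∀ b' ∈ B', η ≤ dist b b' := by
  obtain ⟨η, hη, hd⟩ := h.exists_thickenings hB hB'.isClosed
  refine ⟨η, hη, fun b hb b' hb' => not_lt.1 fun hlt => ?_⟩
  exact Set.disjoint_left.1 hd (Metric.mem_thickening_iff.2 ⟨b, hb, by rwa [dist_comm]⟩)
    (Metric.self_subset_thickening hη _ hb')

theorem isClosed_connectedComponentIn {X : Type*} [TopologicalSpace X] {A : Set X}
    (hA : IsClosed A) (x : X) : IsClosed (connectedComponentIn A x) := by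
  by_cases hx : x ∈ A
  · rw [connectedComponentIn_eq_image hx]
    exact hA.isClosedEmbedding_subtypeVal.isClosedMap _ isClosed_connectedComponent
  · rw [connectedComponentIn_eq_empty hx]
    exact isClosed_empty

theorem isCompact_of_subset_unitCube {d : ℕ} {A : Set (E d)} (hA : IsClosed A)
    (hc : A ⊆ unitCube d) : IsCompact A := by
  refine Metric.isCompact_of_isClosed_isBounded hA
    ((Metric.isBounded_iff_subset_closedBall 0).2 ⟨d * 1, fun x hx => ?_⟩)
  refine Metric.mem_closedBall.2 (dist_le_of_forall_abs_sub_le fun i => ?_)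
  obtain ⟨h₀, h₁⟩ := hc hx i
  simpa [abs_le] using ⟨by linarith, h₁⟩

/-! ### Rational grids of the unit cube -/

/-- Notations of the points of the unit cube with coordinates in `ℕ / (M + 1)`. -/
def gridCodes : ℕ → ℕ → List ℕ
  | 0, _ => [0]
  | d + 1, M => (List.range (M + 2)).flatMap fun k =>
      (gridCodes d M).map fun g => Nat.pair (ratCode k 0 M) g

theorem primrec_gridCodes (d : ℕ) : Primrec (gridCodes d) := by
  induction d with
  | zero => exact .const _
  | succ d ih =>
    have hg : Primrec₂ fun (z : ℕ × ℕ) (g : ℕ) => Nat.pair (ratCode z.2 0 z.1) g :=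
      Primrec₂.natPair.comp (primrec_ratCode (Primrec.snd.comp .fst) (.const 0)
        (Primrec.fst.comp .fst)) .snd
    have hm : Primrec₂ fun M k : ℕ =>
        (gridCodes d M).map fun g => Nat.pair (ratCode k 0 M) g :=
      Primrec.list_map (ih.comp .fst) hg
    exact Primrec.list_flatMap (Primrec.list_range.comp (Primrec.succ.comp .succ)) hm

theorem exists_mem_gridCodes {d : ℕ} (M : ℕ) {z : E d} (hz : z ∈ unitCube d) :
    ∃ g ∈ gridCodes d M, dist z (ratVecOf d g) < ((d : ℝ) + 1) / ((M : ℝ) + 1) := by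
  suffices h : ∀ (d : ℕ) (f : Fin d → ℝ), (∀ i, f i ∈ Set.Icc (0 : ℝ) 1) →
      ∃ g ∈ gridCodes d M, ∀ i, |f i - ratVecOf d g i| ≤ 1 / ((M : ℝ) + 1) by
    obtain ⟨g, hg, hgz⟩ := h d z hz
    -- The factor `d + 1` in place of `d` makes the inequality strict, also for `d = 0`.
    refine ⟨g, hg, (dist_le_of_forall_abs_sub_le hgz).trans_lt ?_⟩
    rw [mul_one_div]
    gcongr
    simp
  intro d
  induction d with
  | zero => exact fun _ _ => ⟨0, by simp [gridCodes], fun i => i.elim0⟩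
  | succ d ih =>
    intro f hf
    obtain ⟨g, hg, hgf⟩ := ih (fun i => f i.succ) fun i => hf i.succ
    have hM : (0 : ℝ) < M + 1 := by positivity
    have h₀ : 0 ≤ f 0 * (M + 1) := mul_nonneg (hf 0).1 hM.le
    have hk := Nat.floor_le h₀
    have hk' := Nat.lt_floor_add_one (f 0 * (M + 1))
    set k := ⌊f 0 * ((M : ℝ) + 1)⌋₊
    -- The value `k = M + 1` occurs for coordinate `1`.
    have hkM : k < M + 2 := by
      have : (k : ℝ) ≤ (M + 1 : ℕ) := by push_cast; nlinarith [(hf 0).2]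
      have : k ≤ M + 1 := by exact_mod_cast this
      omega
    refine ⟨Nat.pair (ratCode k 0 M) g, ?_, Fin.cases ?_ fun i => ?_⟩
    · simp only [gridCodes, List.mem_flatMap, List.mem_range, List.mem_map]
      exact ⟨k, hkM, g, hg, rfl⟩
    · rw [ratVecOf_zero, Nat.unpair_pair, ratOf_ratCode, abs_le]
      push_cast
      rw [sub_zero]
      constructor
      · have h₁ : (k : ℝ) / (M + 1) ≤ f 0 := (div_le_iff₀ hM).2 hk
        have h₂ : (0 : ℝ) ≤ 1 / (M + 1) := by positivity
        linarith
      · rw [sub_le_iff_le_add, ← add_div, le_div_iff₀ hM]; linarith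
    · simpa [ratVecOf_succ] using hgf i

/-! ### Bounded quantifiers -/

section BoundedQuantifiers

variable {α β : Type*} [Primcodable α] [Primcodable β]

theorem primrecPred_forall_mem {R : β → α → Prop} {l : α → List β} (hl : Primrec l)
    (hR : PrimrecRel R) : PrimrecPred fun a => ∀ b ∈ l a, R b a :=
  PrimrecRel.comp (f := l) (g := fun a => a) hR.forall_mem_list hl .id

theorem primrecPred_exists_mem {R : β → α → Prop} {l : α → List β} (hl : Primrec l)
    (hR : PrimrecRel R) : PrimrecPred fun a => ∃ b ∈ l a, R b a :=
  PrimrecRel.comp (f := l) (g := fun a => a) hR.exists_mem_list hl .id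

theorem primrecPred_forall_lt {R : ℕ → α → Prop} {n : α → ℕ} (hn : Primrec n)
    (hR : PrimrecRel R) : PrimrecPred fun a => ∀ k < n a, R k a :=
  (primrecPred_forall_mem (Primrec.list_range.comp hn) hR).of_eq fun a => by simp

theorem primrecPred_exists_lt {R : ℕ → α → Prop} {n : α → ℕ} (hn : Primrec n)
    (hR : PrimrecRel R) : PrimrecPred fun a => ∃ k < n a, R k a :=
  (primrecPred_exists_mem (Primrec.list_range.comp hn) hR).of_eq fun a => by simp

end BoundedQuantifiers

/-! ### Lower bounds of the distance function from a name -/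

theorem Applies.unique {r q : ℕ → ℕ} {n m m' : ℕ} (h : Applies r q n m) (h' : Applies r q n m') :
    m = m' := by
  obtain ⟨k, hk, hlt⟩ := h
  obtain ⟨k', hk', hlt'⟩ := h'
  rcases lt_trichotomy k k' with hc | rfl | hc
  · have := hlt' k hc; omega
  · omega
  · have := hlt k' hc; omega

/-- The argument at which a name of a function is queried for the `n`-th entry of the value at the
constant sequence `g`, after `k` entries have been read. -/
def constQuery (g n k : ℕ) : ℕ :=
  Nat.pair n (Encodable.encode ((List.range k).map fun _ => g))

/-- The query of `constQuery` is answered within the initial segment `P` of the name. -/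
def Answered (P : List ℕ) (g n k : ℕ) : Prop :=
  0 < P.getD (constQuery g n k) 0 ∧ ∀ j < k, P.getD (constQuery g n j) 1 = 0

/-- The initial segment `P` of a name of a real function shows that its value at the rational point
`g` is at least the rational `t`. -/
def BoundFound (P : List ℕ) (g t : ℕ) : Prop :=
  ∃ n < P.length, ∃ k < P.length,
    Answered P g n k ∧ ¬ ratOf (P.getD (constQuery g n k) 0 - 1) < ratOf t

/-- The defaults in `Answered` are chosen adversarially: `0` where a positive entry is required, `1`
where a zero is required. Hence unread entries never count as evidence. -/
theorem Answered.applies {r : ℕ → ℕ} {N g n k : ℕ} (h : Answered (initialSegment r N) g n k) :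
    Applies r (fun _ => g) n ((initialSegment r N).getD (constQuery g n k) 0 - 1) := by
  have hget : ∀ {i : ℕ}, 0 < (initialSegment r N).getD i 0 → (initialSegment r N).getD i 0 = r i := by
    intro i hi
    rcases initialSegment_getD_eq_or r N i 0 with h | h
    · exact h
    · omega
  refine ⟨k, ?_, fun j hj => ?_⟩
  · rw [Nat.sub_add_cancel h.1]
    exact (hget h.1).symm
  · have := h.2 j hj
    rcases initialSegment_getD_eq_or r N (constQuery g n j) 1 with h' | h'
    · exact h'.symm.trans this
    · omega

theorem BoundFound.le {d N g t : ℕ} {r : ℕ → ℕ} {f : E d → ℝ}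
    (hr : functionNaming (rho d) rhoLower r f) (h : BoundFound (initialSegment r N) g t) :
    (ratOf t : ℝ) ≤ f (ratVecOf d g) := by
  obtain ⟨n, -, k, -, ha, hle⟩ := h
  obtain ⟨s, hs, hsup⟩ := hr _ _ (rho_const d g)
  have : (ratOf (s n) : ℝ) ≤ f (ratVecOf d g) := hsup.1 ⟨n, rfl⟩
  rw [(hs n).unique ha.applies] at this
  exact (Rat.cast_le.2 (not_lt.1 hle)).trans this

/-- Some entry of the lower name of the value exceeds `t`, and computing it on the constant name of
the rational point consults only finitely many entries of `r`. -/
theorem eventually_boundFound {d g t : ℕ} {r : ℕ → ℕ} {f : E d → ℝ}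
    (hr : functionNaming (rho d) rhoLower r f) (h : (ratOf t : ℝ) < f (ratVecOf d g)) :
    ∀ᶠ N in Filter.atTop, BoundFound (initialSegment r N) g t := by
  obtain ⟨s, hs, hsup⟩ := hr _ _ (rho_const d g)
  obtain ⟨_, ⟨n, rfl⟩, hn⟩ := (lt_isLUB_iff hsup).1 h
  obtain ⟨k, hk, hlt⟩ := hs n
  obtain ⟨B, hB⟩ := ((Finset.range (k + 1)).image (constQuery g n)).bddAbove
  filter_upwards [Filter.eventually_gt_atTop n, Filter.eventually_gt_atTop k,
    Filter.eventually_gt_atTop B] with N hnN hkN hBN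
  have hget : ∀ a, ∀ j ≤ k, (initialSegment r N).getD (constQuery g n j) a = r (constQuery g n j) :=
    fun a j hj => initialSegment_getD
      ((hB (Finset.mem_coe.2 (Finset.mem_image_of_mem _ (Finset.mem_range_succ_iff.2 hj)))).trans_lt
        hBN) a
  have hk' : r (constQuery g n k) = s n + 1 := hk
  refine ⟨n, by simpa using hnN, k, by simpa using hkN, ⟨?_, fun j hj => ?_⟩, ?_⟩
  · rw [hget 0 k le_rfl, hk']; omega
  · rw [hget 1 j hj.le]; exact hlt j hj
  · rw [hget 0 k le_rfl, hk', Nat.add_sub_cancel, not_lt]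
    exact (Rat.cast_le (K := ℝ)).1 hn.le

theorem primrec_constQuery {α : Type*} [Primcodable α] {g n k : α → ℕ} (hg : Primrec g)
    (hn : Primrec n) (hk : Primrec k) : Primrec fun a => constQuery (g a) (n a) (k a) := by
  have h : Primrec₂ fun (a : α) (_ : ℕ) => g a := hg.comp .fst
  exact Primrec₂.natPair.comp hn (Primrec.encode.comp
    (Primrec.list_map (Primrec.list_range.comp hk) h))

theorem primrecPred_answered {α : Type*} [Primcodable α] {P : α → List ℕ} {g n k : α → ℕ}
    (hP : Primrec P) (hg : Primrec g) (hn : Primrec n) (hk : Primrec k) :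
    PrimrecPred fun a => Answered (P a) (g a) (n a) (k a) := by
  have h₁ := PrimrecRel.comp Primrec.nat_lt (.const 0)
    ((Primrec.list_getD 0).comp hP (primrec_constQuery hg hn hk))
  have hR : PrimrecRel fun (j : ℕ) (a : α) => (P a).getD (constQuery (g a) (n a) j) 1 = 0 :=
    PrimrecRel.comp Primrec.eq ((Primrec.list_getD 1).comp (hP.comp .snd)
      (primrec_constQuery (hg.comp .snd) (hn.comp .snd) .fst)) (.const 0)
  have h₂ := primrecPred_forall_lt hk hR
  exact (h₁.and h₂).of_eq fun _ => Iff.rfl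

theorem primrecPred_boundFound {α : Type*} [Primcodable α] {P : α → List ℕ} {g t : α → ℕ}
    (hP : Primrec P) (hg : Primrec g) (ht : Primrec t) :
    PrimrecPred fun a => BoundFound (P a) (g a) (t a) := by
  have hR : PrimrecRel fun (k : ℕ) (z : ℕ × α) => Answered (P z.2) (g z.2) z.1 k ∧
      ¬ ratOf ((P z.2).getD (constQuery (g z.2) z.1 k) 0 - 1) < ratOf (t z.2) := by
    have hz : Primrec fun w : ℕ × ℕ × α => w.2.2 := Primrec.snd.comp .snd
    have hn : Primrec fun w : ℕ × ℕ × α => w.2.1 := Primrec.fst.comp .snd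
    have h₁ := primrecPred_answered (hP.comp hz) (hg.comp hz) hn .fst
    have h₂ := primrecPred_ratOf_lt (Primrec.pred.comp ((Primrec.list_getD 0).comp (hP.comp hz)
      (primrec_constQuery (hg.comp hz) hn .fst))) (ht.comp hz)
    exact (h₁.and h₂.not).of_eq fun _ => Iff.rfl
  have hlen := Primrec.list_length.comp hP
  have hR' : PrimrecRel fun (n : ℕ) (a : α) => ∃ k < (P a).length, Answered (P a) (g a) n k ∧
      ¬ ratOf ((P a).getD (constQuery (g a) n k) 0 - 1) < ratOf (t a) :=
    primrecPred_exists_lt (hlen.comp .snd) (R := fun k z => _) hR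
  exact (primrecPred_exists_lt hlen hR').of_eq fun _ => Iff.rfl

/-! ### Certified separation of a component from a point -/

/-- The mesh of the grid `gridCodes d M`. -/
def meshCode (d M : ℕ) : ℕ := ratCode (d + 1) 0 M

theorem ratOf_meshCode (d M : ℕ) :
    (ratOf (meshCode d M) : ℝ) = ((d : ℝ) + 1) / ((M : ℝ) + 1) := by
  rw [meshCode, ratOf_ratCode]
  push_cast
  rw [sub_zero]

/-- The points of the list `L` are far from all other points of the grid which have not been
recognized as far from the set named by `P`. -/
def GridSplit (d M : ℕ) (L P : List ℕ) : Prop :=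
  ∀ g ∈ gridCodes d M, (∃ h ∈ L, h = g) ∨ BoundFound P g (meshCode d M) ∨
    ∀ h ∈ L, ¬ DistLt d h g (ratAdd (meshCode d M) (meshCode d M))

/-- The point with name-entry `c` at precision `1 / (m + 1)` is near some point of `L`. -/
def NearList (d M : ℕ) (L : List ℕ) (c m : ℕ) : Prop :=
  ∃ h ∈ L, DistLt d h c (ratSub (meshCode d M) (ratCode 1 0 m))

/-- Every point with name-entry `c` at precision `1 / (m + 1)` has at least the distance `s` from
all balls of the given mesh around points of `L`. -/
def FarFromList (d M : ℕ) (L : List ℕ) (c m s : ℕ) : Prop :=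
  ∀ h ∈ L, ¬ DistLt d h c (ratAdd s (ratAdd (meshCode d M) (ratCode 1 0 m)))

/-- Each point of `A` is within the mesh `η` of a grid point, which therefore cannot have been
recognized as far from `A`. So it belongs to `L` or is at least `2 * η` from all of `L`. The
corresponding two unions of `η`-balls are disjoint and cover `A`, and `x` lies in the first. -/
theorem connectedComponentIn_subset_iUnion_ball {d M m c N : ℕ} {L : List ℕ} {r : ℕ → ℕ}
    {A : Set (E d)} {x : E d} (hA : A ⊆ unitCube d) (hx : x ∈ A)
    (hr : functionNaming (rho d) rhoLower r fun y => Metric.infDist y A)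
    (hc : dist x (ratVecOf d c) ≤ 1 / ((m : ℝ) + 1))
    (hsplit : GridSplit d M L (initialSegment r N)) (hnear : NearList d M L c m) :
    connectedComponentIn A x ⊆
      ⋃ h ∈ L, Metric.ball (ratVecOf d h) (ratOf (meshCode d M) : ℝ) := by
  set η : ℝ := (ratOf (meshCode d M) : ℝ) with hη
  let W : Set (E d) := ⋃ (g : ℕ) (_ : ∀ h ∈ L, η + η ≤ dist (ratVecOf d h) (ratVecOf d g)),
    Metric.ball (ratVecOf d g) η
  refine isPreconnected_connectedComponentIn.subset_left_of_subset_union (v := W)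
    (isOpen_biUnion fun _ _ => Metric.isOpen_ball)
    (isOpen_iUnion fun _ => isOpen_iUnion fun _ => Metric.isOpen_ball) ?_
    ((connectedComponentIn_subset A x).trans fun z hz => ?_)
    ⟨x, mem_connectedComponentIn hx, ?_⟩
  · simp only [W, Set.disjoint_iUnion_left, Set.disjoint_iUnion_right]
    exact fun g hg h hL => Metric.ball_disjoint_ball (hg h hL)
  · obtain ⟨g, hg, hzg⟩ := exists_mem_gridCodes M (hA hz)
    rw [← ratOf_meshCode, ← hη] at hzg
    rcases hsplit g hg with ⟨h, hL, rfl⟩ | hb | hfar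
    · exact .inl (Set.mem_iUnion₂.2 ⟨h, hL, hzg⟩)
    · have h₁ := hb.le hr
      have h₂ := Metric.infDist_le_dist_of_mem (x := ratVecOf d g) hz
      rw [dist_comm] at h₂
      linarith
    · refine .inr (Set.mem_iUnion₂.2 ⟨g, fun h hL => ?_, hzg⟩)
      have := hfar h hL
      rwa [distLt_iff, not_lt, ratOf_ratAdd, Rat.cast_add] at this
  · obtain ⟨h, hL, hh⟩ := hnear
    rw [distLt_iff, ratOf_ratSub, Rat.cast_sub, ratOf_inv_succ] at hh
    refine Set.mem_iUnion₂.2 ⟨h, hL, Metric.mem_ball.2 ?_⟩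
    rw [dist_comm] at hh
    linarith [dist_triangle x (ratVecOf d c) (ratVecOf d h)]

theorem FarFromList.le_infDist {d M m c s : ℕ} {L : List ℕ} {C : Set (E d)} {y : E d}
    (hC : C.Nonempty) (hL : C ⊆ ⋃ h ∈ L, Metric.ball (ratVecOf d h) (ratOf (meshCode d M) : ℝ))
    (hc : dist y (ratVecOf d c) ≤ 1 / ((m : ℝ) + 1)) (h : FarFromList d M L c m s) :
    (ratOf s : ℝ) ≤ Metric.infDist y C := by
  refine (Metric.le_infDist hC).2 fun {z} hz => ?_
  obtain ⟨g, hg, hzg⟩ := Set.mem_iUnion₂.1 (hL hz)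
  have hfar := h g hg
  rw [distLt_iff, not_lt, ratOf_ratAdd, ratOf_ratAdd, Rat.cast_add, Rat.cast_add,
    ratOf_inv_succ] at hfar
  rw [Metric.mem_ball] at hzg
  have h₁ := dist_triangle (ratVecOf d g) z (ratVecOf d c)
  have h₂ := dist_triangle z y (ratVecOf d c)
  rw [dist_comm _ z] at h₁
  rw [dist_comm z y] at h₂
  linarith

theorem exists_certificate {d s : ℕ} {r q q' : ℕ → ℕ} {A : Set (E d)} {x y : E d}
    (hA : IsClosed A) (hAc : A ⊆ unitCube d) (hx : x ∈ A)
    (hr : functionNaming (rho d) rhoLower r fun y => Metric.infDist y A)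
    (hq : rho d q x) (hq' : rho d q' y)
    (hs : (ratOf s : ℝ) < Metric.infDist y (connectedComponentIn A x)) :
    ∃ M L m, (∀ᶠ N in Filter.atTop, GridSplit d M L (initialSegment r N)) ∧
      NearList d M L (q m) m ∧ FarFromList d M L (q' m) m s := by
  classical
  set C := connectedComponentIn A x with hCdef
  set ε : ℝ := Metric.infDist y C - ratOf s with hε
  have hε0 : 0 < ε := sub_pos.2 hs
  obtain ⟨B, B', rfl, hB, hB', hBB', hxB, hBC⟩ :=
    exists_isCompact_split (isCompact_of_subset_unitCube hA hAc) hx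
      (δ := ε / 4) (by positivity)
  obtain ⟨σ, hσ, hsep⟩ := exists_pos_forall_le_dist hB hB' hBB'
  -- With `η < σ / 6`, grid points within `2 * η` of `B` and of `B'` are more than `2 * η` apart.
  -- With `η < ε / 8`, the errors `ε / 4`, `3 * η` and `2 / (m + 1) < ε / 8` add up to less than
  -- `ε`.
  obtain ⟨M, hM⟩ := exists_nat_one_div_lt
    (show 0 < min (σ / 6) (ε / 8) / ((d : ℝ) + 1) by positivity)
  set η : ℝ := (ratOf (meshCode d M) : ℝ) with hη
  have hηM : η = ((d : ℝ) + 1) / ((M : ℝ) + 1) := ratOf_meshCode d M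
  have hη0 : 0 < η := by rw [hηM]; positivity
  have hηlt : η < min (σ / 6) (ε / 8) := by
    rw [lt_div_iff₀ (by positivity), one_div_mul_eq_div] at hM
    rwa [hηM]
  obtain ⟨hησ, hηε⟩ := lt_min_iff.1 hηlt
  -- This list need not be computed from the names: the search runs through all lists, and only its
  -- existence matters.
  let L : List ℕ := (gridCodes d M).filter fun g => ∃ b ∈ B, dist (ratVecOf d g) b < 2 * η
  have hLmem : ∀ {g}, g ∈ L ↔ g ∈ gridCodes d M ∧ ∃ b ∈ B, dist (ratVecOf d g) b < 2 * η := by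
    simp [L]
  obtain ⟨g₀, hg₀, hxg₀⟩ := exists_mem_gridCodes M (hAc hx)
  rw [← hηM] at hxg₀
  obtain ⟨m, hm⟩ := exists_nat_one_div_lt
    (show 0 < min ((η - dist x (ratVecOf d g₀)) / 2) (ε / 16) from
      lt_min (half_pos (sub_pos.2 hxg₀)) (by positivity))
  obtain ⟨hm₁, hm₂⟩ := lt_min_iff.1 hm
  refine ⟨M, L, m, ?_, ⟨g₀, hLmem.2 ⟨hg₀, x, hxB, ?_⟩, ?_⟩, fun h hL => ?_⟩
  · have hev : ∀ g ∈ {g | g ∈ gridCodes d M}, ∀ᶠ N in Filter.atTop,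
        η < Metric.infDist (ratVecOf d g) (B ∪ B') →
          BoundFound (initialSegment r N) g (meshCode d M) := by
      intro g _
      by_cases hg : η < Metric.infDist (ratVecOf d g) (B ∪ B')
      · exact (eventually_boundFound hr hg).mono fun _ h _ => h
      · exact .of_forall fun _ h => absurd h hg
    -- The grid is finite, so one prefix length serves all its points.
    filter_upwards [(Filter.eventually_all_finite (List.finite_toSet _)).2 hev] with N hN g hg
    by_cases hgL : g ∈ L
    · exact .inl ⟨g, hgL, rfl⟩
    by_cases hgA : η < Metric.infDist (ratVecOf d g) (B ∪ B')
    · exact .inr (.inl (hN g hg hgA))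
    refine .inr (.inr fun h hL => ?_)
    obtain ⟨a, ha, hga⟩ := (Metric.infDist_lt_iff ⟨x, hx⟩).1
      (show Metric.infDist (ratVecOf d g) (B ∪ B') < 2 * η by linarith)
    have haB' : a ∈ B' := ha.resolve_left fun haB => hgL (hLmem.2 ⟨hg, a, haB, hga⟩)
    obtain ⟨-, b, hb, hhb⟩ := hLmem.1 hL
    rw [distLt_iff, not_lt, ratOf_ratAdd, Rat.cast_add, ← hη]
    have h₁ := hsep b hb a haB'
    have h₂ := dist_triangle4 b (ratVecOf d h) (ratVecOf d g) a
    rw [dist_comm b (ratVecOf d h)] at h₂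
    linarith
  · rw [dist_comm]; linarith
  · rw [distLt_iff, ratOf_ratSub, Rat.cast_sub, ratOf_inv_succ, ← hη]
    have h₁ := dist_triangle (ratVecOf d g₀) x (ratVecOf d (q m))
    have h₂ := hq.dist_le m
    rw [dist_comm _ x] at h₁
    linarith
  · rw [distLt_iff, not_lt, ratOf_ratAdd, ratOf_ratAdd, Rat.cast_add, Rat.cast_add,
      ratOf_inv_succ, ← hη]
    obtain ⟨-, b, hb, hhb⟩ := hLmem.1 hL
    have h₁ := hBC b hb
    have h₂ := Metric.infDist_le_infDist_add_dist (s := C) (x := y) (y := b)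
    have h₃ := dist_triangle4 y (ratVecOf d (q' m)) (ratVecOf d h) b
    have h₄ := hq'.dist_le m
    rw [dist_comm (ratVecOf d (q' m))] at h₃
    linarith

/-! ### Computability of components of compact sets -/

theorem primrec_meshCode (d : ℕ) : Primrec (meshCode d) :=
  primrec_ratCode (.const (d + 1)) (.const 0) .id

theorem primrecPred_gridSplit (d : ℕ) {α : Type*} [Primcodable α] {M : α → ℕ} {L P : α → List ℕ}
    (hM : Primrec M) (hL : Primrec L) (hP : Primrec P) :
    PrimrecPred fun a => GridSplit d (M a) (L a) (P a) := by
  have hmesh : Primrec fun a => meshCode d (M a) :=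
    (primrec_meshCode d).comp hM
  have e₁ : PrimrecRel fun (h : ℕ) (z : ℕ × α) => h = z.1 :=
    PrimrecRel.comp (f := fun w : ℕ × ℕ × α => w.1) (g := fun w : ℕ × ℕ × α => w.2.1)
      Primrec.eq .fst (Primrec.fst.comp .snd)
  have h₁ := primrecPred_exists_mem (hL.comp (.snd (α := ℕ))) e₁
  have h₂ := primrecPred_boundFound (hP.comp (.snd (α := ℕ))) .fst (hmesh.comp .snd)
  have hmesh₂ : Primrec fun w : ℕ × ℕ × α => meshCode d (M w.2.2) :=
    hmesh.comp (Primrec.snd.comp .snd)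
  have e₃ : PrimrecRel fun (h : ℕ) (z : ℕ × α) =>
      ¬ DistLt d h z.1 (ratAdd (meshCode d (M z.2)) (meshCode d (M z.2))) := by
    have := primrecPred_distLt d .fst (Primrec.fst.comp .snd) (primrec_ratAdd.comp hmesh₂ hmesh₂)
    exact this.not
  have h₃ := primrecPred_forall_mem (hL.comp (.snd (α := ℕ))) e₃
  have h := primrecPred_forall_mem ((primrec_gridCodes d).comp hM) (h₁.or (h₂.or h₃)).primrecRel
  exact h.of_eq fun _ => Iff.rfl

theorem primrecPred_nearList (d : ℕ) {α : Type*} [Primcodable α] {M c m : α → ℕ} {L : α → List ℕ}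
    (hM : Primrec M) (hL : Primrec L) (hc : Primrec c) (hm : Primrec m) :
    PrimrecPred fun a => NearList d (M a) (L a) (c a) (m a) := by
  have ht : Primrec fun a => ratSub (meshCode d (M a)) (ratCode 1 0 (m a)) :=
    primrec_ratSub.comp ((primrec_meshCode d).comp hM)
      (primrec_ratCode (.const 1) (.const 0) hm)
  exact primrecPred_exists_mem
    (R := fun h a => DistLt d h (c a) (ratSub (meshCode d (M a)) (ratCode 1 0 (m a)))) hL
    (primrecPred_distLt d .fst (hc.comp .snd) (ht.comp .snd))

theorem primrecPred_farFromList (d : ℕ) {α : Type*} [Primcodable α] {M c m s : α → ℕ}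
    {L : α → List ℕ} (hM : Primrec M) (hL : Primrec L) (hc : Primrec c) (hm : Primrec m)
    (hs : Primrec s) : PrimrecPred fun a => FarFromList d (M a) (L a) (c a) (m a) (s a) := by
  have ht : Primrec fun a => ratAdd (s a) (ratAdd (meshCode d (M a)) (ratCode 1 0 (m a))) :=
    primrec_ratAdd.comp hs (primrec_ratAdd.comp ((primrec_meshCode d).comp hM)
      (primrec_ratCode (.const 1) (.const 0) hm))
  exact primrecPred_forall_mem
    (R := fun h a => ¬ DistLt d h (c a)
      (ratAdd (s a) (ratAdd (meshCode d (M a)) (ratCode 1 0 (m a))))) hL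
    (primrecPred_distLt d .fst (hc.comp .snd) (ht.comp .snd)).not

/-- The number `⟨N, M, L, m, s⟩` describes a certificate which proves, from initial segments `P`,
`Q`, `w` of names of a set, of a point `x` of it and of a point `y`, that `y` has at least the
distance `s` from the component of `x`. -/
def Certifies (d : ℕ) (z : ℕ × ℕ × List ℕ × ℕ × ℕ) (P Q w : List ℕ) : Prop :=
  (GridSplit d z.2.1 z.2.2.1 P ∧
    NearList d z.2.1 z.2.2.1 (Q.getD z.2.2.2.1 0) z.2.2.2.1) ∧
    FarFromList d z.2.1 z.2.2.1 (w.getD z.2.2.2.1 0) z.2.2.2.1 z.2.2.2.2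

open Classical in
/-- The answer of the certificate `z` to the initial segment `w` of the name of a point. -/
noncomputable def certifiedBound (d : ℕ) (z : ℕ × ℕ × List ℕ × ℕ × ℕ) (P Q w : List ℕ) : ℕ :=
  if w.length ≤ z.2.2.2.1 then 0 else if Certifies d z P Q w then z.2.2.2.2 + 1 else 1

/-- The entries of the name of the distance function of the component: the query `⟨n, w⟩` is
answered as soon as the initial segment `w` of the name of a point is long enough for the
certificate `n`. -/
noncomputable def componentDistEntry (d a : ℕ) (P Q : List ℕ) : ℕ :=
  certifiedBound d (Denumerable.ofNat (ℕ × ℕ × List ℕ × ℕ × ℕ) a.unpair.1) P Q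
    (Denumerable.ofNat (List ℕ) a.unpair.2)

theorem primrec_componentDistEntry (d : ℕ) :
    Primrec fun a : ℕ × List ℕ × List ℕ => componentDistEntry d a.1 a.2.1 a.2.2 := by
  classical
  have hz : Primrec fun a : ℕ × List ℕ × List ℕ =>
      Denumerable.ofNat (ℕ × ℕ × List ℕ × ℕ × ℕ) a.1.unpair.1 :=
    (Primrec.ofNat _).comp (Primrec.fst.comp (Primrec.unpair.comp .fst))
  have hw : Primrec fun a : ℕ × List ℕ × List ℕ => Denumerable.ofNat (List ℕ) a.1.unpair.2 :=
    (Primrec.ofNat _).comp (Primrec.snd.comp (Primrec.unpair.comp .fst))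
  have hP : Primrec fun a : ℕ × List ℕ × List ℕ => a.2.1 := Primrec.fst.comp .snd
  have hQ : Primrec fun a : ℕ × List ℕ × List ℕ => a.2.2 := Primrec.snd.comp .snd
  have h₁ := Primrec.snd.comp hz
  have hM := Primrec.fst.comp h₁
  have h₂ := Primrec.snd.comp h₁
  have hL := Primrec.fst.comp h₂
  have h₃ := Primrec.snd.comp h₂
  have hm := Primrec.fst.comp h₃
  have hs := Primrec.snd.comp h₃
  have hsplit := primrecPred_gridSplit d hM hL hP
  have hnear := primrecPred_nearList d hM hL ((Primrec.list_getD 0).comp hQ hm) hm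
  have hfar := primrecPred_farFromList d hM hL ((Primrec.list_getD 0).comp hw hm) hm hs
  have hcert : PrimrecPred fun a : ℕ × List ℕ × List ℕ =>
      Certifies d (Denumerable.ofNat (ℕ × ℕ × List ℕ × ℕ × ℕ) a.1.unpair.1) a.2.1 a.2.2
        (Denumerable.ofNat (List ℕ) a.1.unpair.2) :=
    ((hsplit.and hnear).and hfar).of_eq fun _ => Iff.rfl
  have hlen := PrimrecRel.comp Primrec.nat_le (Primrec.list_length.comp hw) hm
  exact (Primrec.ite hlen (.const 0) (Primrec.ite hcert (Primrec.succ.comp hs) (.const 1))).of_eq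
    fun a => by rw [componentDistEntry, certifiedBound]

/-! ### Correctness of the name of the distance function -/

theorem componentDistEntry_pair_encode (d n : ℕ) (w P Q : List ℕ) :
    componentDistEntry d (Nat.pair n (Encodable.encode w)) P Q =
      certifiedBound d (Denumerable.ofNat (ℕ × ℕ × List ℕ × ℕ × ℕ) n) P Q w := by
  rw [componentDistEntry, Nat.unpair_pair, Denumerable.ofNat_encode]

open Classical in
-- The summand `1` is the shift in `Applies`. A failed certificate answers the code `0` of the
-- rational `0`, a trivial lower bound for a distance.
theorem certifiedBound_of_lt {d : ℕ} {z : ℕ × ℕ × List ℕ × ℕ × ℕ} {P Q w : List ℕ}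
    (h : z.2.2.2.1 < w.length) :
    certifiedBound d z P Q w = (if Certifies d z P Q w then z.2.2.2.2 else 0) + 1 := by
  rw [certifiedBound, if_neg (not_le.2 h)]
  split_ifs <;> rfl

theorem certifiedBound_of_le {d : ℕ} {z : ℕ × ℕ × List ℕ × ℕ × ℕ} {P Q w : List ℕ}
    (h : w.length ≤ z.2.2.2.1) : certifiedBound d z P Q w = 0 := by
  rw [certifiedBound, if_pos h]

theorem Certifies.le_infDist {d N N' : ℕ} {z : ℕ × ℕ × List ℕ × ℕ × ℕ} {r q q' : ℕ → ℕ}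
    {A : Set (E d)} {x y : E d} (hA : A ⊆ unitCube d) (hx : x ∈ A)
    (hr : functionNaming (rho d) rhoLower r fun y => Metric.infDist y A)
    (hq : rho d q x) (hq' : rho d q' y) (hN : z.2.2.2.1 < N)
    (h : Certifies d z (initialSegment r N') (initialSegment q N)
      (initialSegment q' (z.2.2.2.1 + 1))) :
    (ratOf z.2.2.2.2 : ℝ) ≤ Metric.infDist y (connectedComponentIn A x) := by
  obtain ⟨⟨hsplit, hnear⟩, hfar⟩ := h
  rw [initialSegment_getD hN] at hnear
  rw [initialSegment_getD (Nat.lt_succ_self _)] at hfar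
  exact hfar.le_infDist ⟨x, mem_connectedComponentIn hx⟩
    (connectedComponentIn_subset_iUnion_ball hA hx hr (hq.dist_le _) hsplit hnear) (hq'.dist_le _)

/-- Pairing dominates its components, so prefixes longer than the certificate's code reach the entry
at precision `m`. -/
theorem precision_le (n : ℕ) : (Denumerable.ofNat (ℕ × ℕ × List ℕ × ℕ × ℕ) n).2.2.2.1 ≤ n := by
  simp only [Denumerable.prod_ofNat_val, Denumerable.ofNat_nat]
  exact (Nat.unpair_left_le _).trans ((Nat.unpair_right_le _).trans
    ((Nat.unpair_right_le _).trans (Nat.unpair_right_le _)))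

theorem psiUpper_componentDistEntry {d : ℕ} {A : Set (E d)} {x : E d} {r q : ℕ → ℕ}
    (hA : IsClosed A) (hAc : A ⊆ unitCube d) (hx : x ∈ A) (hr : psiUpper d r A)
    (hq : rho d q x) :
    psiUpper d
      (fun a => componentDistEntry d a (initialSegment r (a + 1)) (initialSegment q (a + 1)))
      (connectedComponentIn A x) := by
  classical
  have hr' := hr.2.2
  refine ⟨isClosed_connectedComponentIn hA x, ⟨x, mem_connectedComponentIn hx⟩, fun y q' hq' => ?_⟩
  let z : ℕ → ℕ × ℕ × List ℕ × ℕ × ℕ := fun n => Denumerable.ofNat _ n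
  let a : ℕ → ℕ := fun n =>
    Nat.pair n (Encodable.encode (initialSegment q' ((z n).2.2.2.1 + 1)))
  let Cert : ℕ → Prop := fun n => Certifies d (z n) (initialSegment r (a n + 1))
    (initialSegment q (a n + 1)) (initialSegment q' ((z n).2.2.2.1 + 1))
  have hprec : ∀ n, (z n).2.2.2.1 ≤ n := precision_le
  have hna : ∀ n, n ≤ a n := fun n => Nat.left_le_pair _ _
  refine ⟨fun n => if Cert n then (z n).2.2.2.2 else 0, fun n => ?_, ?_, fun b hb => ?_⟩
  -- Exactly `m + 1` entries of the name of `y` are read, the first length at which its entry `m` is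
  -- available.
  · refine ⟨(z n).2.2.2.1 + 1, ?_, fun j hj => ?_⟩
    · change componentDistEntry d (a n) (initialSegment r (a n + 1))
        (initialSegment q (a n + 1)) = _
      rw [componentDistEntry_pair_encode]
      exact certifiedBound_of_lt (by rw [length_initialSegment]; exact Nat.lt_succ_self _)
    · change componentDistEntry d (Nat.pair n (Encodable.encode (initialSegment q' j))) _ _ = 0
      rw [componentDistEntry_pair_encode]
      exact certifiedBound_of_le (by rw [length_initialSegment]; exact Nat.le_of_lt_succ hj)
  · rintro _ ⟨n, rfl⟩
    dsimp only
    split_ifs with h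
    · exact Certifies.le_infDist hAc hx hr' hq hq'
        (Nat.lt_succ_of_le ((hprec n).trans (hna n))) h
    · simpa using Metric.infDist_nonneg
  · by_contra hlt
    obtain ⟨t, hbt, ht⟩ := exists_rat_btwn (not_le.1 hlt)
    obtain ⟨s, rfl⟩ := ratOf_surjective t
    obtain ⟨M, L, m, hsplit, hnear, hfar⟩ := exists_certificate hA hAc hx hr' hq hq' ht
    obtain ⟨N, hN⟩ := Filter.eventually_atTop.1 hsplit
    obtain ⟨n, hn⟩ : ∃ n, n = Encodable.encode (N, M, L, m, s) := ⟨_, rfl⟩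
    have hzn : z n = (N, M, L, m, s) := by rw [hn]; exact Denumerable.ofNat_encode _
    -- The padding `N` in the code forces the prefix of `r` to be long enough for `GridSplit` to
    -- hold.
    have hNn : N ≤ n := by
      rw [hn, Encodable.encode_prod_val]
      exact Nat.left_le_pair _ _
    have hmn : m ≤ n := by simpa only [hzn] using hprec n
    have hcert : Cert n := by
      simp only [Cert, hzn]
      refine ⟨⟨hN _ ((hNn.trans (hna n)).trans (Nat.le_succ _)), ?_⟩, ?_⟩
      · rwa [initialSegment_getD (Nat.lt_succ_of_le (hmn.trans (hna n)))]
      · rwa [initialSegment_getD (Nat.lt_succ_self _)]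
    have := hb ⟨n, rfl⟩
    simp only [if_pos hcert, hzn] at this
    exact absurd this (not_le.2 hbt)

theorem isComputableMap_connectedComponentIn_isClosed (d : ℕ) :
    IsComputableMap (psiUpper d) (rho d) (psiUpper d)
      {z : Set (E d) × E d | IsClosed z.1 ∧ z.1 ⊆ unitCube d ∧ z.2 ∈ z.1}
      (fun A x => connectedComponentIn A x) :=
  ⟨_, .of_initialSegments (primrec_componentDistEntry d), fun _ _ hD _ _ hp hq =>
    ⟨_, fun _ => Part.mem_some _, psiUpper_componentDistEntry hD.1 hD.2.1 hD.2.2 hp hq⟩⟩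

end RealComp

theorem propositionp (d : ℕ) :
    -- (a)
    ((∀ U : Set (RealComp.E d), RealComp.IsREOpen d U → ∀ x ∈ U,
        RealComp.IsREOpen d (connectedComponentIn U x)) ∧
      (∀ U : Set (RealComp.E d), IsOpen U → ∀ x ∈ U,
        IsOpen (connectedComponentIn U x) ∧ pathComponentIn U x = connectedComponentIn U x) ∧
      RealComp.IsComputableMap (RealComp.thetaLower d) (RealComp.rho d) (RealComp.thetaLower d)
        {z : Set (RealComp.E d) × RealComp.E d | IsOpen z.1 ∧ z.2 ∈ z.1}
        (fun U x => connectedComponentIn U x)) ∧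
    -- (b)
    ((∀ A : Set (RealComp.E d), IsClosed A → A ⊆ RealComp.unitCube d → ∀ x ∈ A,
        IsClosed (connectedComponentIn A x) ∧
          connectedComponentIn A x ⊆ RealComp.unitCube d) ∧
      RealComp.IsComputableMap (RealComp.psiUpper d) (RealComp.rho d) (RealComp.psiUpper d)
        {z : Set (RealComp.E d) × RealComp.E d |
          IsClosed z.1 ∧ z.1 ⊆ RealComp.unitCube d ∧ z.2 ∈ z.1}
        (fun A x => connectedComponentIn A x)) := by
  exact ⟨⟨fun _ hU _ hx => RealComp.isREOpen_connectedComponentIn hU hx,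
      fun _ hU _ hx => ⟨hU.connectedComponentIn,
        RealComp.pathComponentIn_eq_connectedComponentIn hU hx⟩,
      RealComp.isComputableMap_connectedComponentIn_isOpen d⟩,
    fun A hA hAc x _ => ⟨RealComp.isClosed_connectedComponentIn hA x,
      (connectedComponentIn_subset A x).trans hAc⟩,
    RealComp.isComputableMap_connectedComponentIn_isClosed d⟩
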